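/- **Setting.** Let $M$ be a closed $3$-manifold (compact, Hausdorff, locally homeomorphic to $\mathbb R^3$) and let $L=L_1\cup\dots\cup L_n$ be a framed link in $M$, i.e. an embedding of a disjoint union of $n$ thickened circles $L_i:[0,1]\times S^1\to M$. The core curve of $L_i$ is $L_i(\{0\}\times S^1)$, and the complement $M\setminus L$ is the complement of the union of the core curves. Let $(I,J)$ be a partition of $\{1,\dots,n\}$ ($I$ or $J$ may be empty), $L_I=\bigcup_{i\in I}L_i$, $L_J=\bigcup_{j\in J}L_j$. Choose tubular neighborhoods of $L_I$ adapted to the framing: open embeddings $\varphi_i:\mathbb C\times S^1\to M$ $(i\in I)$ with pairwise disjoint images, disjoint from the annuli $L_j$, $j\in J$, such that for some $w_i\in(0,1]$ one has $\varphi_i(t,s)=L_i(w_it,s)$ for all $t\in[0,1]$, $s\in S^1$. Put $D^2=\{|z|\le 1\}\subset\mathbb C$, $N_i=\varphi_i(D^2\times S^1)$, and let $\mu_i=\varphi_i(\partial D^2\times\{1\})$ be the meridian of $N_i$. (For a smooth framed link in an oriented $3$-manifold such neighborhoods always exist.) **Surgery.** $M_{L_I}$ is obtained from $M$ by removing $\varphi_i(\mathrm{int}\,D^2\times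 S^1)$ for every $i\in I$ and gluing in solid tori $V_i=D^2\times S^1$, where $(z,w)\in\partial D^2\times S^1=\partial V_i$ is identified with $\varphi_i(w,z)$; so the meridian $\partial D^2\times\{1\}$ of $V_i$ is glued to the parallel copy $\varphi_i(\{1\}\times S^1)$ of $L_i$. **Change of pair.** Let $L_I^*=\bigcup_{i\in I}L_i^*$ be such that $L_I^*\cup L_J$ is a framed link in $M$, the annuli $L_i^*$ are disjoint from all $N_k$ $(k\in I)$, and the link formed by the core curves of $L_I^*$ is isotopic in $M\setminus L$ to the link of meridians $\bigcup_{i\in I}\mu_i$, the core of $L_i^*$ being carried to $\mu_i$; here an isotopy in $M\setminus L$ is an ambient isotopy $(h_t)_{t\in[0,1]}$ of $M$, $h_0=\mathrm{id}$, fixing pointwise a neighborhood of the core curves of $L$. The framing of each $L_i^*$ is arbitrary. The change-of-pair operation $T_{(L_I;L_I^*)}$ sends $(M,L)$ to $(M^*,L^*)$, where $M^*=M_{L_I}$ and $L^*=L_I^*\cup L_J$, regarded as a framed link in $M^*$. **Proposition.** If $(M^*,L^*)$ is obtained from $(M,L)$ by a change-of-pair operation, then $M^*\setminus L^*$ is homeomorphic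 to $M\setminus L$. -/

import Mathlib

open Set Topology

universe u v

/-- A framed link in `M` with components indexed by `ι`: a topological embedding into `M` of the
disjoint union over `i : ι` of the thickened circles `[0,1] × S¹`. -/
structure FramedLink (M : Type u) [TopologicalSpace M] (ι : Type v) where
  /-- the annulus `L_i : [0,1] × S¹ → M` -/
  annulus : ι → unitInterval → Circle → M
  isEmbedding : IsEmbedding
    (fun p : (_ : ι) × (unitInterval × Circle) => annulus p.1 p.2.1 p.2.2)

namespace FramedLink

variable {M : Type u} [TopologicalSpace M] {ι : Type v}

/-- The core curve `L_i({0} × S¹)` of the `i`-th component. -/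
def core (L : FramedLink M ι) (i : ι) : Set M := range (L.annulus i 0)

/-- The (unframed) link underlying a framed link: the union of the core curves. -/
def link (L : FramedLink M ι) : Set M := ⋃ i, L.core i

/-- The link complement `M ∖ L`, with the subspace topology. -/
abbrev Complement (L : FramedLink M ι) : Type u := ↥(L.linkᶜ)

end FramedLink

/-- Tubular neighborhoods of the components `L_i`, `i ∈ I`, of a framed link, parametrized by the
open solid tori `ℂ × S¹`, pairwise disjoint, disjoint from the other components, and adapted to
the framing: the radius `[0,1] × S¹` runs along the part `[0, w_i] × S¹` of the annulus `L_i`,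
for some `0 < w_i ≤ 1`.  The closed tubular neighborhood in which surgery is done is the image
of `D² × S¹`, where `D²` is the closed unit disk of `ℂ`; its core is the core curve of `L_i`, and
its longitude `{1} × S¹` is a parallel copy of `L_i`. -/
structure TubularNeighborhood {M : Type u} [TopologicalSpace M] {ι : Type v}
    (L : FramedLink M ι) (I : Set ι) where
  tube : I → ℂ → Circle → M
  isOpenEmbedding : IsOpenEmbedding
    (fun p : (_ : I) × (ℂ × Circle) => tube p.1 p.2.1 p.2.2)
  width : I → unitInterval
  width_pos : ∀ i, 0 < width i
  framing : ∀ (i : I) (t : unitInterval) (s : Circle),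
    tube i ((t : ℝ) : ℂ) s = L.annulus i (width i * t) s
  disjoint : ∀ (i : I) (z : ℂ) (s : Circle) (j : ι), j ∉ I →
    ∀ (t : unitInterval) (s' : Circle), tube i z s ≠ L.annulus j t s'

namespace TubularNeighborhood

variable {M : Type u} [TopologicalSpace M] {ι : Type v} {L : FramedLink M ι} {I : Set ι}

/-- The closed tubular neighborhood `⋃ i ∈ I, N_i` of `L_I`. -/
def closedTube (T : TubularNeighborhood L I) : Set M :=
  {x | ∃ (i : I) (z : ℂ) (s : Circle), ‖z‖ ≤ 1 ∧ T.tube i z s = x}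

/-- The interior of the closed tubular neighborhood. -/
def openTube (T : TubularNeighborhood L I) : Set M :=
  {x | ∃ (i : I) (z : ℂ) (s : Circle), ‖z‖ < 1 ∧ T.tube i z s = x}

/-- The meridian of the closed tubular neighborhood of `L_i`: the curve `∂D² × {1}`. -/
def meridian (T : TubularNeighborhood L I) (i : I) : Set M :=
  range (fun w : Circle => T.tube i (w : ℂ) 1)

/-- The exterior of `L_I`: what remains of `M` after removing the open solid tori. -/
abbrev Exterior (T : TubularNeighborhood L I) : Type u := ↥(T.openTubeᶜ)

/-- The solid tori `D² × S¹`, one for each `i ∈ I`, to be glued in by the surgery. -/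
abbrev SolidTori (_T : TubularNeighborhood L I) : Type v :=
  (_ : I) × (Metric.closedBall (0 : ℂ) 1 × Circle)

theorem boundary_notMem_openTube (T : TubularNeighborhood L I) (i : I) (w z : Circle) :
    T.tube i (w : ℂ) z ∈ T.openTubeᶜ := by
  rintro ⟨j, y, s, hy, h⟩
  have h2 : (⟨j, (y, s)⟩ : (_ : I) × (ℂ × Circle)) = ⟨i, ((w : ℂ), z)⟩ :=
    T.isOpenEmbedding.injective h
  have h3 : y = (w : ℂ) := congrArg (fun p : (_ : I) × (ℂ × Circle) => p.2.1) h2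
  rw [h3, Circle.norm_coe] at hy
  exact lt_irrefl _ hy

/-- The gluing of the surgery: the boundary point `(z, w)` of the `i`-th solid torus `D² × S¹`
is identified with the point of the boundary torus of the removed tube with coordinates `(w, z)`.
So each meridian `∂D² × {w}` of the new solid torus is glued to a longitude, the one with
`w = 1` being glued to the parallel copy of `L_i`. -/
inductive Glue (T : TubularNeighborhood L I) :
    T.Exterior ⊕ T.SolidTori → T.Exterior ⊕ T.SolidTori → Prop
  | glue (i : I) (z w : Circle) :
      Glue T (Sum.inr ⟨i, (⟨(z : ℂ), mem_closedBall_zero_iff.mpr (Circle.norm_coe z).le⟩, w)⟩)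
        (Sum.inl ⟨T.tube i (w : ℂ) z, T.boundary_notMem_openTube i w z⟩)

/-- The space `M_{L_I}` obtained from `M` by surgery along the framed link `L_I`, with the
quotient topology. -/
def Surgery (T : TubularNeighborhood L I) : Type (max u v) := Quot T.Glue

instance (T : TubularNeighborhood L I) : TopologicalSpace T.Surgery :=
  inferInstanceAs (TopologicalSpace (Quot T.Glue))

/-- The canonical map from the exterior to the surgered space. -/
def ofExterior (T : TubularNeighborhood L I) (x : T.Exterior) : T.Surgery :=
  Quot.mk T.Glue (Sum.inl x)

theorem notMem_openTube (T : TubularNeighborhood L I) {x : M} (hx : x ∉ T.closedTube) :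
    x ∈ T.openTubeᶜ :=
  fun ⟨i, z, s, hz, h⟩ => hx ⟨i, z, s, hz.le, h⟩

/-- The canonical map from the complement of the closed tubular neighborhood to the surgered
space. -/
def ofCompl (T : TubularNeighborhood L I) (x : ↥(T.closedTubeᶜ)) : T.Surgery :=
  T.ofExterior ⟨x.1, T.notMem_openTube x.2⟩

theorem ofCompl_injective (T : TubularNeighborhood L I) : Function.Injective T.ofCompl := by
  intro x y hxy
  let P : T.Surgery → Prop := Quot.lift
    (fun q => Sum.elim (fun e : T.Exterior => (e : M) = x.1)
      (fun v => ∃ z : Circle, (z : ℂ) = v.2.1 ∧ T.tube v.1 (v.2.2 : ℂ) z = x.1) q) (by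
      rintro _ _ ⟨i, z, w⟩
      simp only [Sum.elim_inr, Sum.elim_inl, Circle.coe_inj, exists_eq_left])
  have hx : P (T.ofCompl x) := rfl
  rw [hxy] at hx
  exact Subtype.ext (show y.1 = x.1 from hx).symm

theorem isClosed_closedTube [T2Space M] [Finite ι] (T : TubularNeighborhood L I) :
    IsClosed T.closedTube := by
  have : T.closedTube = ⋃ i : I, (fun p : ℂ × Circle => T.tube i p.1 p.2) ''
      (Metric.closedBall (0 : ℂ) 1 ×ˢ univ) := by
    ext x
    simp [closedTube]
  rw [this]
  refine isClosed_iUnion_of_finite fun i => IsCompact.isClosed ?_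
  refine ((isCompact_closedBall _ _).prod isCompact_univ).image ?_
  exact T.isOpenEmbedding.continuous.comp (continuous_sigmaMk (σ := fun _ : I => ℂ × Circle))

theorem isOpenEmbedding_ofCompl [T2Space M] [Finite ι] (T : TubularNeighborhood L I) :
    IsOpenEmbedding T.ofCompl := by
  refine .of_continuous_injective_isOpenMap ?_ T.ofCompl_injective ?_
  · exact continuous_quot_mk.comp (continuous_inl.comp
      (continuous_subtype_val.subtype_mk fun x => T.notMem_openTube x.2))
  · intro U hU
    have key : Quot.mk T.Glue ⁻¹' (T.ofCompl '' U) =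
        Sum.inl '' {e : T.Exterior | ∃ h : (e : M) ∈ T.closedTubeᶜ, (⟨e, h⟩ : ↥(T.closedTubeᶜ)) ∈ U} := by
      let P : T.Surgery → Prop := Quot.lift
        (fun q => Sum.elim (fun e : T.Exterior =>
          ∃ h : (e : M) ∈ T.closedTubeᶜ, (⟨e, h⟩ : ↥(T.closedTubeᶜ)) ∈ U) (fun _ => False) q) (by
          rintro _ _ ⟨i, z, w⟩
          simp only [Sum.elim_inr, Sum.elim_inl, eq_iff_iff, false_iff]
          rintro ⟨h, _⟩
          exact h ⟨i, w, z, (Circle.norm_coe w).le, rfl⟩)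
      ext q
      constructor
      · rintro ⟨x, hx, hq⟩
        have h1 : P (T.ofCompl x) := ⟨x.2, hx⟩
        rw [hq] at h1
        rcases q with e | v
        · exact ⟨e, h1, rfl⟩
        · exact h1.elim
      · rintro ⟨e, ⟨h, he⟩, rfl⟩
        exact ⟨⟨e, h⟩, he, rfl⟩
    change IsOpen (Quot.mk T.Glue ⁻¹' (T.ofCompl '' U))
    rw [key]
    refine isOpenMap_inl _ ?_
    obtain ⟨V, hV, rfl⟩ := isOpen_induced_iff.mp hU
    have hopen : IsOpen {e : T.Exterior | (e : M) ∈ V ∧ (e : M) ∉ T.closedTube} :=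
      (hV.inter T.isClosed_closedTube.isOpen_compl).preimage continuous_subtype_val
    convert hopen using 1
    ext e
    exact ⟨fun ⟨h, he⟩ => ⟨he, h⟩, fun ⟨he, h⟩ => ⟨h, he⟩⟩

end TubularNeighborhood

/-- An ambient isotopy of `M` relative to `A`: a continuous path `h_t`, `t ∈ [0,1]`, of
homeomorphisms of `M` with `h_0 = id`, all fixing some neighborhood of `A` pointwise.  If `M` is
compact, this is an ambient isotopy with compact support of `M ∖ A`. -/
structure AmbientIsotopy (M : Type u) [TopologicalSpace M] (A : Set M) where
  toHomeo : unitInterval → M ≃ₜ M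
  continuous : Continuous (fun p : unitInterval × M => toHomeo p.1 p.2)
  start : ∀ x, toHomeo 0 x = x
  fixed : ∃ U : Set M, IsOpen U ∧ A ⊆ U ∧ ∀ t, ∀ x ∈ U, toHomeo t x = x

/-- The data of a change-of-pair operation `T_{(L_I; L_I^*)}` on `(M, L)`: the set `I` of
components (with complement `J`), tubular neighborhoods of the components of `L_I`, and the framed
link `L_I^* ∪ L_J` in the complement in `M` of the tubular neighborhoods, where the core curves of
`L_I^*` are isotopic in `M ∖ L`, by one isotopy for all `i ∈ I`, to the meridians of the
tubular neighborhoods.  The framing of `L_i^*` is arbitrary. -/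
structure ChangeOfPair {M : Type u} [TopologicalSpace M] {ι : Type v}
    (L : FramedLink M ι) where
  I : Set ι
  nhd : TubularNeighborhood L I
  replaced : FramedLink M ι
  replaced_of_notMem : ∀ j, j ∉ I → replaced.annulus j = L.annulus j
  notMem_closedTube : ∀ i ∈ I, ∀ t s, replaced.annulus i t s ∉ nhd.closedTube
  isotopy : AmbientIsotopy M L.link
  isotopy_core : ∀ i : I, isotopy.toHomeo 1 '' replaced.core i = nhd.meridian i

namespace ChangeOfPair

variable {M : Type u} [TopologicalSpace M] {ι : Type v} {L : FramedLink M ι}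

/-- The new manifold `M^* = M_{L_I}`. -/
abbrev NewManifold (T : ChangeOfPair L) : Type (max u v) := T.nhd.Surgery

theorem replaced_notMem_closedTube (T : ChangeOfPair L) (i : ι) (t : unitInterval) (s : Circle) :
    T.replaced.annulus i t s ∈ T.nhd.closedTubeᶜ := by
  by_cases hi : i ∈ T.I
  · exact T.notMem_closedTube i hi t s
  · rintro ⟨k, z, s', -, h⟩
    rw [T.replaced_of_notMem i hi] at h
    exact T.nhd.disjoint k z s' i hi t s h

/-- The new framed link `L^* = L_I^* ∪ L_J`, as a framed link in `M^*`. -/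
def newLink [T2Space M] [Finite ι] (T : ChangeOfPair L) : FramedLink T.NewManifold ι where
  annulus i t s := T.nhd.ofCompl ⟨T.replaced.annulus i t s, T.replaced_notMem_closedTube i t s⟩
  isEmbedding := T.nhd.isOpenEmbedding_ofCompl.isEmbedding.comp
    (T.replaced.isEmbedding.codRestrict _ fun p => T.replaced_notMem_closedTube p.1 p.2.1 p.2.2)

end ChangeOfPair

/-! The solid torus glued in for `L_i`, together with the rest of the old open tube, forms an open
solid torus `S¹ × ℂ` in `M^*` (`newTube`). Its part `‖y‖ ≥ 1` is matched with the old tube outside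
the removed torus by `swapPolar`, which also identifies `S¹ × (ℂ ∖ {0})` with the whole old tube
minus its core. The meridian pushed out to radius `r > 1` is `S¹ × {r}` in the new coordinates. A
homeomorphism of the plane supported in a disk and moving `r` to `0` identifies `S¹ × (ℂ ∖ {r})`
with `S¹ × (ℂ ∖ {0})`. Extended by the identity, it identifies the complement of the pushed
meridians and of `L_J` in `M^*` with `M ∖ L` (`nonempty_homeomorph_compl_meridianLink`).

It remains to replace these meridians by `L_I^*`. The end `h` of the isotopy carries the cores of
`L_I^*` to the meridians, but it need not preserve the tubes, so it does not act on `M^*`. It is the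
identity near `L`, however. Conjugating it with a homeomorphism that shrinks the tubes into the
region fixed by `h` gives `H` fixing the closed tubes pointwise
(`exists_homeomorph_fixing_closedTube`), and such an `H` extends over the surgery
(`exists_homeomorph_surgery`). The same conjugation pushes the target meridians from radius `1` to a
radius `r > 1`, off the closed tubes. The framing of `L_I^*` plays no role, since complements only
see cores. -/

/-! ### Gluing homeomorphisms from open pieces -/

/-- Two continuous open maps with the same kernel have homeomorphic ranges. -/
theorem exists_homeomorph_range_of_isOpenMap {P X Y : Type*} [TopologicalSpace P]
    [TopologicalSpace X] [TopologicalSpace Y] {f : P → X} {g : P → Y} (hfc : Continuous f)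
    (hfo : IsOpenMap f) (hgc : Continuous g) (hgo : IsOpenMap g)
    (h : ∀ p q, f p = f q ↔ g p = g q) :
    ∃ F : range f ≃ₜ range g, ∀ p, F ⟨f p, mem_range_self p⟩ = ⟨g p, mem_range_self p⟩ := by
  have hf : IsOpenQuotientMap (rangeFactorization f) :=
    ⟨rangeFactorization_surjective, hfc.rangeFactorization, hfo.subtype_mk _⟩
  have hg : IsOpenQuotientMap (rangeFactorization g) :=
    ⟨rangeFactorization_surjective, hgc.rangeFactorization, hgo.subtype_mk _⟩
  have key : ∀ p q, rangeFactorization f p = rangeFactorization f q ↔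
      rangeFactorization g p = rangeFactorization g q := fun p q => by
    simpa [rangeFactorization, Subtype.ext_iff] using h p q
  -- Preimages are chosen arbitrarily; the equality of kernels makes the choice immaterial.
  let F : range f → range g := fun x => rangeFactorization g (hf.surjective x).choose
  let G : range g → range f := fun x => rangeFactorization f (hg.surjective x).choose
  have hF : ∀ p, F (rangeFactorization f p) = rangeFactorization g p := fun p =>
    (key _ _).1 (hf.surjective _).choose_spec
  have hG : ∀ p, G (rangeFactorization g p) = rangeFactorization f p := fun p =>
    (key _ _).2 (hg.surjective _).choose_spec
  refine ⟨⟨⟨F, G, fun x => ?_, fun x => ?_⟩, ?_, ?_⟩, hF⟩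
  · obtain ⟨p, rfl⟩ := hf.surjective x
    rw [hF, hG]
  · obtain ⟨p, rfl⟩ := hg.surjective x
    rw [hG, hF]
  · refine hf.isQuotientMap.continuous_iff.2 ?_
    convert hg.continuous using 1
    exact funext hF
  · refine hg.isQuotientMap.continuous_iff.2 ?_
    convert hf.continuous using 1
    exact funext hG

/-- A homeomorphism of an open subspace which is the identity off a set that is closed in the
whole space extends by the identity. -/
theorem Topology.IsOpenEmbedding.exists_homeomorph_extend {X B : Type*} [TopologicalSpace X]
    [TopologicalSpace B] {e : B → X} (he : IsOpenEmbedding e) (f : B ≃ₜ B) {C : Set B}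
    (hC : IsClosed (e '' C)) (hf : ∀ b ∉ C, f b = b) :
    ∃ F : X ≃ₜ X, (∀ b, F (e b) = e (f b)) ∧ ∀ x ∉ e '' C, F x = x := by
  have hA : IsOpenEmbedding (Subtype.val : ↥((e '' C)ᶜ) → X) :=
    hC.isOpen_compl.isOpenEmbedding_subtypeVal
  have hef : IsOpenEmbedding (e ∘ f) := he.comp f.isOpenEmbedding
  have hcover : ∀ {e' : B → X}, range e' = range e → e '' C ⊆ range e' →
      range (Sum.elim (Subtype.val : ↥((e '' C)ᶜ) → X) e') = univ := by
    intro e' h1 h2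
    rw [Sum.elim_range, Subtype.range_coe, eq_univ_iff_forall]
    intro x
    by_cases hx : x ∈ e '' C
    · exact Or.inr (h2 hx)
    · exact Or.inl hx
  have hmix : ∀ (x : ↥((e '' C)ᶜ)) (b : B), x.1 = e b ↔ x.1 = e (f b) := by
    rintro ⟨x, hx⟩ b
    change x = e b ↔ x = e (f b)
    constructor
    · rintro rfl
      rw [hf b fun hb => hx ⟨b, hb, rfl⟩]
    · rintro rfl
      -- Off `C` the map fixes `f b`, so `f (f b) = f b`, and injectivity gives `f b = b`.
      have h1 : f b ∉ C := fun hb => hx ⟨_, hb, rfl⟩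
      rw [f.injective (hf _ h1)]
  -- Both `e` and `e ∘ f` present `X` as an image of `(X ∖ e '' C) ⊔ B`. The pieces overlap only
  -- where `f` is the identity, so the kernels agree.
  obtain ⟨F, hF⟩ := exists_homeomorph_range_of_isOpenMap
    (f := Sum.elim (Subtype.val : ↥((e '' C)ᶜ) → X) e)
    (g := Sum.elim (Subtype.val : ↥((e '' C)ᶜ) → X) (e ∘ f))
    (hA.continuous.sumElim he.continuous) (hA.isOpenMap.sumElim he.isOpenMap)
    (hA.continuous.sumElim hef.continuous) (hA.isOpenMap.sumElim hef.isOpenMap) (by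
      rintro (p | p) (q | q)
      · rfl
      · exact hmix p q
      · simpa [eq_comm] using hmix q p
      · simp [he.injective.eq_iff])
  have h1 := hcover rfl (image_subset_range e C)
  have h3 : range (e ∘ f) = range e := f.surjective.range_comp e
  have h2 := hcover h3 (h3 ▸ image_subset_range e C)
  refine ⟨(Homeomorph.Set.univ X).symm.trans ((Homeomorph.setCongr h1.symm).trans
    (F.trans ((Homeomorph.setCongr h2).trans (Homeomorph.Set.univ X)))), fun b => ?_,
    fun x hx => ?_⟩
  · exact congrArg Subtype.val (hF (Sum.inr b))
  · exact congrArg Subtype.val (hF (Sum.inl ⟨x, hx⟩))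

/-! ### Compactly supported homeomorphisms of the plane -/

/-- A continuous bijection of a proper space which is the identity off a bounded set is a
homeomorphism. -/
theorem exists_homeomorph_of_bijective_of_eq_off_bounded {E : Type*} [NormedAddCommGroup E]
    [ProperSpace E] {f : E → E} (hc : Continuous f) (hb : Function.Bijective f) {R : ℝ}
    (hR : ∀ x, R ≤ ‖x‖ → f x = x) : ∃ F : E ≃ₜ E, ∀ x, F x = f x := by
  have hev : id =ᶠ[Filter.cocompact E] f := by
    filter_upwards [(tendsto_norm_cocompact_atTop (E := E)).eventually_ge_atTop R] with x hx
    exact (hR x hx).symm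
  have hp : IsProperMap f :=
    isProperMap_iff_tendsto_cocompact.2 ⟨hc, Filter.tendsto_id.congr' hev⟩
  exact ⟨(Equiv.ofBijective f hb).toHomeomorphOfContinuousClosed hc hp.isClosedMap, fun x => rfl⟩

/-- There is a compactly supported radial homeomorphism of the plane which shrinks the unit disk
into a given disk, with support in a given disk larger than the unit disk. -/
theorem exists_homeomorph_shrink {R δ : ℝ} (hR : 1 < R) (hδ : 0 < δ) :
    ∃ σ : ℂ ≃ₜ ℂ, (∀ z, ‖z‖ ≤ 1 → ‖σ z‖ ≤ δ) ∧ (∀ z, R ≤ ‖z‖ → σ z = z) ∧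
      ∃ r : ℝ, 1 < r ∧ ∀ w : Circle, σ (r * w) = w := by
  have hR0 : 0 < R := by linarith
  -- The radial factor `c` below has `c 1 = R⁻¹ ^ k`. Being less than `δ`, it sends the unit disk
  -- into the `δ`-disk; being less than `1`, it forces the radius sent to `1` to exceed `1`.
  obtain ⟨k, hk⟩ := exists_pow_lt_of_lt_one (lt_min hδ one_pos) (inv_lt_one_of_one_lt₀ hR)
  have hkδ := hk.trans_le (min_le_left _ _)
  have hk1 := hk.trans_le (min_le_right _ _)
  let c : ℝ → ℝ := fun t => min 1 (t / R) ^ k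
  have hcc : Continuous c := by fun_prop
  have hc0 : ∀ t, 0 ≤ t → 0 ≤ c t := fun t ht => by positivity
  have hcpos : ∀ t, 0 < t → 0 < c t := fun t ht => by positivity
  have hcm : ∀ s t, 0 ≤ s → s ≤ t → c s ≤ c t := fun s t hs hst => by
    refine pow_le_pow_left₀ (by positivity) (min_le_min le_rfl ?_) k
    gcongr
  have hcR : ∀ t, R ≤ t → c t = 1 := fun t ht => by
    simp [c, min_eq_left ((one_le_div hR0).2 ht)]
  have hlt : ∀ s t, 0 ≤ s → s < t → s * c s < t * c t := fun s t hs hst =>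
    (mul_le_mul_of_nonneg_left (hcm s t hs hst.le) hs).trans_lt
      (mul_lt_mul_of_pos_right hst (hcpos t (hs.trans_lt hst)))
  have hiv : ∀ u, 0 ≤ u → ∃ t, 0 ≤ t ∧ t * c t = u := by
    intro u hu
    have hm : 0 ≤ max u R := hu.trans (le_max_left _ _)
    -- At the right end `max u R` the factor `c` equals `1`, so `t * c t` attains there a value at
    -- least `u`.
    have := intermediate_value_Icc hm (f := fun t => t * c t) (by fun_prop)
    obtain ⟨t, ht, h⟩ := this (show u ∈ _ by
      simp only [zero_mul, hcR _ (le_max_right u R), mul_one]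
      exact ⟨hu, le_max_left _ _⟩)
    exact ⟨t, ht.1, h⟩
  let f : ℂ → ℂ := fun z => (c ‖z‖ : ℝ) * z
  have hfn : ∀ z, ‖f z‖ = ‖z‖ * c ‖z‖ := fun z => by
    simp [f, abs_of_nonneg (hc0 _ (norm_nonneg z)), mul_comm]
  have hfR : ∀ z, R ≤ ‖z‖ → f z = z := fun z hz => by simp [f, hcR _ hz]
  have hfc : Continuous f := by fun_prop
  have hinj : Function.Injective f := by
    intro z y h
    have h1 : ‖z‖ * c ‖z‖ = ‖y‖ * c ‖y‖ := by rw [← hfn, ← hfn, h]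
    have h2 : ‖z‖ = ‖y‖ := by
      rcases lt_trichotomy ‖z‖ ‖y‖ with h3 | h3 | h3
      · exact absurd h1 (hlt _ _ (norm_nonneg _) h3).ne
      · exact h3
      · exact absurd h1 (hlt _ _ (norm_nonneg _) h3).ne'
    rcases eq_or_ne y 0 with rfl | hy
    · simpa using h2
    · have : (c ‖y‖ : ℂ) ≠ 0 := by exact_mod_cast (hcpos _ (norm_pos_iff.2 hy)).ne'
      simp only [f, h2] at h
      exact mul_left_cancel₀ this h
  have hray : ∀ u : ℝ, 0 ≤ u → ∃ t : ℝ, 0 ≤ t ∧ t * c t = u ∧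
      ∀ w : Circle, f (t * w) = u * w := by
    intro u hu
    obtain ⟨t, ht, h⟩ := hiv u hu
    refine ⟨t, ht, h, fun w => ?_⟩
    simp only [f, norm_mul, Circle.norm_coe, mul_one, Complex.norm_real, Real.norm_eq_abs,
      abs_of_nonneg ht, ← h]
    push_cast
    ring
  have hsurj : Function.Surjective f := by
    intro z
    obtain ⟨t, -, -, h⟩ := hray ‖z‖ (norm_nonneg z)
    refine ⟨_, (h (Circle.exp z.arg)).trans ?_⟩
    rw [Circle.coe_exp, Complex.norm_mul_exp_arg_mul_I]
  obtain ⟨σ, hσ⟩ := exists_homeomorph_of_bijective_of_eq_off_bounded hfc ⟨hinj, hsurj⟩ hfR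
  obtain ⟨r, hr0, hr, h⟩ := hray 1 zero_le_one
  have hc1 : c 1 = R⁻¹ ^ k := by
    simp [c, min_eq_right (inv_lt_one_of_one_lt₀ hR).le]
  refine ⟨σ, fun z hz => ?_, fun z hz => (hσ z).trans (hfR z hz), r, ?_, fun w => ?_⟩
  · rw [hσ, hfn]
    calc ‖z‖ * c ‖z‖ ≤ 1 * c 1 :=
          mul_le_mul hz (hcm _ _ (norm_nonneg z) hz) (hc0 _ (norm_nonneg z)) zero_le_one
      _ ≤ δ := by rw [one_mul, hc1]; exact hkδ.le
  · by_contra! hr1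
    have := mul_le_mul hr1 (hcm _ _ hr0 hr1) (hc0 _ hr0) zero_le_one
    rw [hr, hc1, one_mul] at this
    linarith
  · rw [hσ, h]
    simp

/-- There is a compactly supported homeomorphism of the plane which moves a given point to the
origin. -/
theorem exists_homeomorph_move {p : ℂ} {R : ℝ} (hp : ‖p‖ < R) :
    ∃ ψ : ℂ ≃ₜ ℂ, ψ p = 0 ∧ ∀ z, R ≤ ‖z‖ → ψ z = z := by
  have hR : 0 < R := (norm_nonneg p).trans_lt hp
  -- `f` sends `0` to `p`, so `ψ` will be its inverse. The bump `b` is `1 / R`-Lipschitz, so `f -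
  -- id` has Lipschitz constant `‖p‖ / R < 1`, and such a perturbation of the identity is a
  -- homeomorphism.
  let b : ℂ → ℝ := fun z => max 0 (1 - ‖z‖ / R)
  let f : ℂ → ℂ := fun z => z + b z * p
  have hb : ∀ x y, |b x - b y| ≤ ‖x - y‖ / R := fun x y => by
    calc |b x - b y| ≤ |(1 - ‖x‖ / R) - (1 - ‖y‖ / R)| := by
          have := abs_max_sub_max_le_max 0 (1 - ‖x‖ / R) 0 (1 - ‖y‖ / R)
          simpa using this
      _ = |‖y‖ - ‖x‖| / R := by rw [← abs_of_pos hR, ← abs_div, abs_of_pos hR]; congr 1; ring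
      _ ≤ ‖x - y‖ / R := by
          rw [norm_sub_rev]
          exact div_le_div_of_nonneg_right (abs_norm_sub_norm_le y x) hR.le
  have hcR : ∀ z, R ≤ ‖z‖ → f z = z := fun z hz => by
    have : b z = 0 := max_eq_left (by rw [sub_nonpos]; exact (one_le_div hR).2 hz)
    simp [f, this]
  have happ : ApproximatesLinearOn f ((ContinuousLinearEquiv.refl ℝ ℂ : ℂ ≃L[ℝ] ℂ) : ℂ →L[ℝ] ℂ)
      univ (‖p‖ / R).toNNReal := by
    intro x _ y _
    have : f x - f y - (x - y) = ((b x - b y : ℝ) : ℂ) * p := by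
      simp only [f]; push_cast; ring
    simp only [ContinuousLinearEquiv.coe_refl, ContinuousLinearMap.coe_id', id, this, norm_mul,
      Complex.norm_real, Real.norm_eq_abs]
    rw [Real.coe_toNNReal _ (by positivity)]
    calc |b x - b y| * ‖p‖ ≤ ‖x - y‖ / R * ‖p‖ := by gcongr; exact hb x y
      _ = ‖p‖ / R * ‖x - y‖ := by ring
  let F : ℂ ≃ₜ ℂ := happ.toHomeomorph f (Or.inr (by
    have : ‖(ContinuousLinearMap.id ℝ ℂ)‖₊ = 1 := ContinuousLinearMap.nnnorm_id
    simp only [ContinuousLinearEquiv.refl_symm, ContinuousLinearEquiv.coe_refl, this, inv_one]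
    rw [← NNReal.coe_lt_coe, Real.coe_toNNReal _ (by positivity), NNReal.coe_one]
    exact (div_lt_one hR).2 hp))
  have hF : ∀ z, F z = f z := fun z => rfl
  refine ⟨F.symm, ?_, fun z hz => ?_⟩
  · rw [Homeomorph.symm_apply_eq, hF]
    simp [f, b]
  · rw [Homeomorph.symm_apply_eq, hF, hcR z hz]

/-- Every neighborhood of `D × S¹`, where `D` is a closed disk, contains `D' × S¹` for a larger
disk `D'`. -/
theorem eventually_closedBall_prod_subset {O : Set (ℂ × Circle)} (hO : IsOpen O) {r : ℝ}
    (hr : 0 ≤ r) (h : ∀ z s, ‖z‖ ≤ r → (z, s) ∈ O) :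
    ∀ᶠ ε in 𝓝[>] (0 : ℝ), ∀ z s, ‖z‖ ≤ r + ε → (z, s) ∈ O := by
  have hK : IsCompact (Metric.closedBall (0 : ℂ) r ×ˢ (univ : Set Circle)) :=
    (isCompact_closedBall _ _).prod isCompact_univ
  obtain ⟨d, hd, hd'⟩ := hK.exists_cthickening_subset_open hO (by
    rintro ⟨z, s⟩ ⟨hz, -⟩
    exact h z s (by simpa using hz))
  filter_upwards [Ioo_mem_nhdsGT hd] with ε hε z s hz
  refine hd' ?_
  have hz' : z ∈ Metric.cthickening ε (Metric.closedBall (0 : ℂ) r) := by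
    rw [cthickening_closedBall hε.1.le hr, mem_closedBall_zero_iff]
    linarith
  rw [(isCompact_closedBall _ _).cthickening_eq_biUnion_closedBall hε.1.le] at hz'
  obtain ⟨y, hy, hzy⟩ := mem_iUnion₂.1 hz'
  refine Metric.cthickening_mono hε.2.le _
    (Metric.mem_cthickening_of_dist_le _ (y, s) _ _ ⟨hy, mem_univ _⟩ ?_)
  simpa [Prod.dist_eq, hε.1.le] using hzy

/-! ### Polar coordinates and the exchange of the two circle factors -/

/-- The direction `y / |y|` of a nonzero complex number (with the value `1` at `0`). -/
noncomputable def Complex.direction (y : ℂ) : Circle := Circle.exp y.arg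

theorem Complex.norm_mul_direction (y : ℂ) : (‖y‖ : ℂ) * y.direction = y := by
  rw [direction, Circle.coe_exp, norm_mul_exp_arg_mul_I]

theorem Complex.coe_direction {y : ℂ} (hy : y ≠ 0) : (y.direction : ℂ) = y / ‖y‖ := by
  have : (‖y‖ : ℂ) ≠ 0 := by exact_mod_cast norm_ne_zero_iff.2 hy
  rw [eq_div_iff this, mul_comm, norm_mul_direction]

/-- Continuity comes from the formula `y / ‖y‖`, since `arg` itself jumps along the negative real
axis. -/
theorem Complex.continuousOn_direction : ContinuousOn direction {y | y ≠ 0} := by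
  rw [(IsInducing.mk rfl : IsInducing fun z : Circle => (z : ℂ)).continuousOn_iff]
  refine ContinuousOn.congr (f := fun y : ℂ => y / ‖y‖) ?_ fun y hy => coe_direction hy
  exact continuousOn_id.div (by fun_prop) fun y hy => by exact_mod_cast norm_ne_zero_iff.2 hy

theorem Complex.direction_mul {t : ℝ} (ht : 0 < t) (w : Circle) :
    direction ((t : ℂ) * w) = w := by
  have h : (t : ℂ) ≠ 0 := by exact_mod_cast ht.ne'
  apply Circle.ext
  rw [coe_direction (mul_ne_zero h w.coe_ne_zero)]
  simp [Circle.norm_coe, abs_of_pos ht, h]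

/-- Multiplication by `S¹` in the two factors of `S¹ × ℂ` and `ℂ × S¹`: with `r > 0`, the point
`(w, r s)` corresponds to `(r w, s)`. -/
noncomputable def swapPolar : OpenPartialHomeomorph (Circle × ℂ) (ℂ × Circle) where
  toFun p := ((‖p.2‖ : ℂ) * p.1, p.2.direction)
  invFun q := (q.1.direction, (‖q.1‖ : ℂ) * q.2)
  source := {p | p.2 ≠ 0}
  target := {q | q.1 ≠ 0}
  map_source' p hp := mul_ne_zero (by exact_mod_cast norm_ne_zero_iff.2 hp) p.1.coe_ne_zero
  map_target' q hq := mul_ne_zero (by exact_mod_cast norm_ne_zero_iff.2 hq) q.2.coe_ne_zero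
  left_inv' p hp := by
    ext1
    · exact Complex.direction_mul (norm_pos_iff.2 hp) _
    · simp [Circle.norm_coe, Complex.norm_mul_direction]
  right_inv' q hq := by
    ext1
    · simp [Circle.norm_coe, Complex.norm_mul_direction]
    · exact Complex.direction_mul (norm_pos_iff.2 hq) _
  open_source := isOpen_ne_fun continuous_snd continuous_const
  open_target := isOpen_ne_fun continuous_fst continuous_const
  continuousOn_toFun := by
    refine ContinuousOn.prodMk (by fun_prop) ?_
    exact Complex.continuousOn_direction.comp continuousOn_snd fun p hp => hp
  continuousOn_invFun := by
    refine ContinuousOn.prodMk ?_ (by fun_prop)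
    exact Complex.continuousOn_direction.comp continuousOn_fst fun p hp => hp

theorem swapPolar_apply (p : Circle × ℂ) :
    swapPolar p = ((‖p.2‖ : ℂ) * p.1, p.2.direction) := rfl

theorem norm_swapPolar_fst (p : Circle × ℂ) : ‖(swapPolar p).1‖ = ‖p.2‖ := by
  simp [swapPolar_apply, Circle.norm_coe]

theorem swapPolar_ofReal {r : ℝ} (hr : 0 < r) (w : Circle) :
    swapPolar (w, (r : ℂ)) = ((r : ℂ) * w, 1) := by
  have : Complex.direction (r : ℂ) = 1 := by
    simpa using Complex.direction_mul hr 1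
  simp [swapPolar_apply, this, abs_of_pos hr]

/-! ### Coordinates on the old tubes and on the surgered space -/

namespace TubularNeighborhood

variable {M : Type u} [TopologicalSpace M] {ι : Type v} {L : FramedLink M ι} {I : Set ι}

/-- The tube with its coordinates paired. -/
def pairTube (T : TubularNeighborhood L I) (i : I) (q : ℂ × Circle) : M := T.tube i q.1 q.2

theorem isOpenEmbedding_pairTube (T : TubularNeighborhood L I) (i : I) :
    IsOpenEmbedding (T.pairTube i) :=
  T.isOpenEmbedding.comp (.sigmaMk (σ := fun _ : I => ℂ × Circle) (i := i))

theorem pairTube_inj (T : TubularNeighborhood L I) {i j : I} {p q : ℂ × Circle}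
    (h : T.pairTube i p = T.pairTube j q) : i = j ∧ p = q := by
  have : (⟨i, p⟩ : (_ : I) × (ℂ × Circle)) = ⟨j, q⟩ := T.isOpenEmbedding.injective h
  simpa using this

theorem pairTube_mem_closedTube (T : TubularNeighborhood L I) {i : I} {q : ℂ × Circle} :
    T.pairTube i q ∈ T.closedTube ↔ ‖q.1‖ ≤ 1 := by
  constructor
  · rintro ⟨j, z, s, hz, h⟩
    obtain ⟨rfl, rfl⟩ := T.pairTube_inj (p := (z, s)) h
    exact hz
  · exact fun h => ⟨i, q.1, q.2, h, rfl⟩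

theorem pairTube_mem_openTube (T : TubularNeighborhood L I) {i : I} {q : ℂ × Circle} :
    T.pairTube i q ∈ T.openTube ↔ ‖q.1‖ < 1 := by
  constructor
  · rintro ⟨j, z, s, hz, h⟩
    obtain ⟨rfl, rfl⟩ := T.pairTube_inj (p := (z, s)) h
    exact hz
  · exact fun h => ⟨i, q.1, q.2, h, rfl⟩

theorem pairTube_zero (T : TubularNeighborhood L I) (i : I) (s : Circle) :
    T.pairTube i (0, s) = L.annulus i 0 s := by
  simpa [pairTube] using T.framing i 0 s

theorem pairTube_mem_core (T : TubularNeighborhood L I) {i : I} {q : ℂ × Circle} {j : ι} :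
    T.pairTube i q ∈ L.core j ↔ i = j ∧ q.1 = 0 := by
  constructor
  · rintro ⟨s, h⟩
    by_cases hj : j ∈ I
    · rw [show L.annulus j 0 s = L.annulus ((⟨j, hj⟩ : I) : ι) 0 s from rfl, ← pairTube_zero] at h
      obtain ⟨rfl, rfl⟩ := T.pairTube_inj h
      exact ⟨rfl, rfl⟩
    · exact absurd h.symm (T.disjoint i q.1 q.2 j hj 0 s)
  · rintro ⟨rfl, h⟩
    refine ⟨q.2, ?_⟩
    rw [← pairTube_zero, ← h]

theorem swapPolar_mem_exterior (T : TubularNeighborhood L I) (i : I) {p : Circle × ℂ}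
    (hp : 1 ≤ ‖p.2‖) : T.pairTube i (swapPolar p) ∈ T.openTubeᶜ := by
  rw [mem_compl_iff, pairTube_mem_openTube, norm_swapPolar_fst]
  exact hp.not_gt

/-- The open solid torus in the surgered space which consists of a solid torus that has been glued
in and of the part of the old tube outside the removed solid torus. -/
noncomputable def newTube (T : TubularNeighborhood L I) (i : I) (p : Circle × ℂ) : T.Surgery :=
  if h : ‖p.2‖ ≤ 1 then
    Quot.mk T.Glue (Sum.inr ⟨i, (⟨p.2, mem_closedBall_zero_iff.2 h⟩, p.1)⟩)
  else T.ofExterior ⟨T.pairTube i (swapPolar p), T.swapPolar_mem_exterior i (not_le.1 h).le⟩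

theorem newTube_of_le (T : TubularNeighborhood L I) (i : I) {p : Circle × ℂ} (h : ‖p.2‖ ≤ 1) :
    T.newTube i p = Quot.mk T.Glue (Sum.inr ⟨i, (⟨p.2, mem_closedBall_zero_iff.2 h⟩, p.1)⟩) :=
  dif_pos h

/-- Only the torus `‖p.2‖ = 1` needs an argument: there `swapPolar` keeps both circle coordinates,
and the two formulas are identified by `Glue`. -/
theorem newTube_of_ge (T : TubularNeighborhood L I) (i : I) {p : Circle × ℂ} (h : 1 ≤ ‖p.2‖) :
    T.newTube i p = T.ofExterior ⟨T.pairTube i (swapPolar p), T.swapPolar_mem_exterior i h⟩ := by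
  by_cases h1 : ‖p.2‖ ≤ 1
  · have hn : ‖p.2‖ = 1 := le_antisymm h1 h
    obtain ⟨w, y⟩ := p
    have hy : (y.direction : ℂ) = y := by
      simpa [show ‖y‖ = 1 from hn] using Complex.norm_mul_direction y
    rw [newTube_of_le _ _ h1]
    have h2 : (⟨y, mem_closedBall_zero_iff.2 h1⟩ : Metric.closedBall (0 : ℂ) 1) =
        ⟨y.direction, mem_closedBall_zero_iff.2 (Circle.norm_coe _).le⟩ := Subtype.ext hy.symm
    rw [show (⟨(w, y).2, mem_closedBall_zero_iff.2 h1⟩ : Metric.closedBall (0 : ℂ) 1) = _ from h2]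
    refine (Quot.sound (Glue.glue i y.direction w)).trans (congrArg T.ofExterior (Subtype.ext ?_))
    simp [pairTube, swapPolar_apply, show ‖y‖ = 1 from hn]
  · exact dif_neg h1

open Classical in
/-- A normal form for the points of the surgered space: the points of the exterior are represented
by themselves and those of the open solid tori by their coordinates. -/
noncomputable def normalForm (T : TubularNeighborhood L I) :
    T.Surgery → M ⊕ (I × (Circle × ℂ)) :=
  Quot.lift (Sum.elim (fun e => Sum.inl e.1) fun v =>
    if ‖(v.2.1 : ℂ)‖ < 1 then Sum.inr (v.1, (v.2.2, v.2.1))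
    else Sum.inl (T.pairTube v.1 (swapPolar (v.2.2, v.2.1)))) (by
      rintro _ _ ⟨i, z, w⟩
      have hz : Complex.direction z = z := by
        simpa using Complex.direction_mul one_pos z
      simp [Circle.norm_coe, pairTube, swapPolar_apply, hz])

theorem normalForm_ofExterior (T : TubularNeighborhood L I) (e : T.Exterior) :
    T.normalForm (T.ofExterior e) = Sum.inl e.1 := rfl

theorem normalForm_newTube_of_lt (T : TubularNeighborhood L I) (i : I) {p : Circle × ℂ}
    (h : ‖p.2‖ < 1) : T.normalForm (T.newTube i p) = Sum.inr (i, p) := by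
  rw [newTube_of_le _ _ h.le]
  exact if_pos h

theorem normalForm_newTube_of_ge (T : TubularNeighborhood L I) (i : I) {p : Circle × ℂ}
    (h : 1 ≤ ‖p.2‖) : T.normalForm (T.newTube i p) = Sum.inl (T.pairTube i (swapPolar p)) := by
  rw [newTube_of_ge _ _ h, normalForm_ofExterior]

theorem swapPolar_inj {p q : Circle × ℂ} (hp : p.2 ≠ 0) (hq : q.2 ≠ 0)
    (h : swapPolar p = swapPolar q) : p = q :=
  swapPolar.injOn hp hq h

/-- Applying `normalForm` turns equality in the quotient into equality of coordinates, so the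
equivalence relation generated by `Glue` never has to be described. -/
theorem newTube_inj (T : TubularNeighborhood L I) {i j : I} {p q : Circle × ℂ} :
    T.newTube i p = T.newTube j q ↔ i = j ∧ p = q := by
  refine ⟨fun h => ?_, by rintro ⟨rfl, rfl⟩; rfl⟩
  have h' := congrArg T.normalForm h
  rcases lt_or_ge ‖p.2‖ 1 with hp | hp <;> rcases lt_or_ge ‖q.2‖ 1 with hq | hq
  · rw [normalForm_newTube_of_lt _ _ hp, normalForm_newTube_of_lt _ _ hq] at h'
    simpa using h'
  · rw [normalForm_newTube_of_lt _ _ hp, normalForm_newTube_of_ge _ _ hq] at h'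
    simp at h'
  · rw [normalForm_newTube_of_ge _ _ hp, normalForm_newTube_of_lt _ _ hq] at h'
    simp at h'
  · rw [normalForm_newTube_of_ge _ _ hp, normalForm_newTube_of_ge _ _ hq] at h'
    obtain ⟨rfl, h2⟩ := T.pairTube_inj (Sum.inl_injective h')
    exact ⟨rfl, swapPolar_inj (norm_pos_iff.1 (one_pos.trans_le hp))
      (norm_pos_iff.1 (one_pos.trans_le hq)) h2⟩

/-- This is the overlap of the exterior with the new tube: the transition map is `swapPolar`, and
`p.2 ≠ 0` records that `p` lies in its source. -/
theorem ofExterior_eq_newTube (T : TubularNeighborhood L I) {e : T.Exterior} {i : I}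
    {p : Circle × ℂ} : T.ofExterior e = T.newTube i p ↔
      p.2 ≠ 0 ∧ (e : M) = T.pairTube i (swapPolar p) := by
  constructor
  · intro h
    have h' := congrArg T.normalForm h
    rcases lt_or_ge ‖p.2‖ 1 with hp | hp
    · rw [normalForm_newTube_of_lt _ _ hp, normalForm_ofExterior] at h'
      simp at h'
    · rw [normalForm_newTube_of_ge _ _ hp, normalForm_ofExterior] at h'
      exact ⟨norm_pos_iff.1 (one_pos.trans_le hp), Sum.inl_injective h'⟩
  · rintro ⟨-, h⟩
    have hp : 1 ≤ ‖p.2‖ := by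
      have := e.2
      rwa [h, mem_compl_iff, pairTube_mem_openTube, norm_swapPolar_fst, not_lt] at this
    rw [newTube_of_ge _ _ hp]
    exact congrArg _ (Subtype.ext h)

theorem continuous_newTube (T : TubularNeighborhood L I) (i : I) : Continuous (T.newTube i) := by
  have h1 : ContinuousOn (T.newTube i) {p | ‖p.2‖ ≤ 1} := by
    rw [continuousOn_iff_continuous_domRestrict]
    have : Continuous fun p : {p : Circle × ℂ | ‖p.2‖ ≤ 1} => (Quot.mk T.Glue
        (Sum.inr ⟨i, (⟨p.1.2, mem_closedBall_zero_iff.2 p.2⟩, p.1.1)⟩) : T.Surgery) := by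
      refine continuous_quot_mk.comp (continuous_inr.comp (continuous_sigmaMk.comp ?_))
      fun_prop
    refine this.congr fun p => ?_
    exact (T.newTube_of_le i p.2).symm
  have h2 : ContinuousOn (T.newTube i) {p | 1 ≤ ‖p.2‖} := by
    rw [continuousOn_iff_continuous_domRestrict]
    have : Continuous fun p : {p : Circle × ℂ | 1 ≤ ‖p.2‖} => T.ofExterior
        ⟨T.pairTube i (swapPolar p), T.swapPolar_mem_exterior i p.2⟩ := by
      refine continuous_quot_mk.comp (continuous_inl.comp (Continuous.subtype_mk ?_ _))
      refine (T.isOpenEmbedding_pairTube i).continuous.comp ?_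
      exact (swapPolar.continuousOn.mono fun p (hp : 1 ≤ ‖p.2‖) =>
        norm_pos_iff.1 (one_pos.trans_le hp)).domRestrict
    refine this.congr fun p => ?_
    exact (T.newTube_of_ge i p.2).symm
  rw [← continuousOn_univ]
  refine (h1.union_of_isClosed h2 (isClosed_le (by fun_prop) (by fun_prop))
    (isClosed_le (by fun_prop) (by fun_prop))).mono fun p _ => le_total ‖p.2‖ 1

theorem isOpen_pairTube_swapPolar_image (T : TubularNeighborhood L I) (i : I)
    {U : Set (Circle × ℂ)} (hU : IsOpen U) (h0 : U ⊆ swapPolar.source) :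
    IsOpen ((fun p => T.pairTube i (swapPolar p)) '' U) := by
  rw [← image_image (T.pairTube i)]
  exact (T.isOpenEmbedding_pairTube i).isOpenMap _ (swapPolar.isOpen_image_of_subset_source hU h0)

/-- Openness is tested on preimages in the exterior and in each solid torus. In the exterior the
preimage is the trace of an open set of `M`, the image of `U` minus the center under `swapPolar` and
the old tube. -/
theorem isOpenMap_newTube (T : TubularNeighborhood L I) (i : I) : IsOpenMap (T.newTube i) := by
  intro U hU
  change IsOpen (Quot.mk T.Glue ⁻¹' (T.newTube i '' U))
  rw [isOpen_sum_iff]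
  constructor
  · have := (T.isOpen_pairTube_swapPolar_image i (hU.inter swapPolar.open_source)
      inter_subset_right).preimage (continuous_subtype_val (p := (· ∈ T.openTubeᶜ)))
    convert this using 1
    ext e
    constructor
    · rintro ⟨p, hp, h⟩
      obtain ⟨h1, h2⟩ := T.ofExterior_eq_newTube.1 h.symm
      exact ⟨p, ⟨hp, h1⟩, h2.symm⟩
    · rintro ⟨p, ⟨hp, h1⟩, h2⟩
      exact ⟨p, hp, (T.ofExterior_eq_newTube.2 ⟨h1, h2.symm⟩).symm⟩
  · rw [isOpen_sigma_iff]
    intro j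
    by_cases hj : j = i
    · subst hj
      have := hU.preimage (f := fun v : Metric.closedBall (0 : ℂ) 1 × Circle => (v.2, (v.1 : ℂ)))
        (by fun_prop)
      convert this using 1
      ext v
      have hv : Quot.mk T.Glue (Sum.inr ⟨j, v⟩) = T.newTube j (v.2, (v.1 : ℂ)) :=
        (T.newTube_of_le j (p := (v.2, (v.1 : ℂ))) (mem_closedBall_zero_iff.1 v.1.2)).symm
      constructor
      · rintro ⟨p, hp, h⟩
        rwa [(T.newTube_inj.1 (h.trans hv)).2] at hp
      · exact fun h => ⟨_, h, hv.symm⟩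
    · convert isOpen_empty
      rw [eq_empty_iff_forall_notMem]
      rintro v ⟨p, hp, h⟩
      have hv : Quot.mk T.Glue (Sum.inr ⟨j, v⟩) = T.newTube j (v.2, (v.1 : ℂ)) :=
        (T.newTube_of_le j (p := (v.2, (v.1 : ℂ))) (mem_closedBall_zero_iff.1 v.1.2)).symm
      exact hj (T.newTube_inj.1 (h.trans hv)).1.symm

/-- The exterior points missed by `ofCompl` lie on the boundary tori, which the new tubes cover. -/
theorem exists_ofCompl_or_newTube (T : TubularNeighborhood L I) (x : T.Surgery) :
    (∃ e, T.ofCompl e = x) ∨ ∃ i p, T.newTube i p = x := by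
  obtain ⟨e | v, rfl⟩ := Quot.exists_rep x
  · by_cases he : (e : M) ∈ T.closedTube
    · obtain ⟨i, z, s, hz, h⟩ := he
      have hz1 : 1 ≤ ‖z‖ := by
        have := e.2
        rwa [← h, mem_compl_iff, show T.tube i z s = T.pairTube i (z, s) from rfl,
          pairTube_mem_openTube, not_lt] at this
      have h0 : (z, s) ∈ swapPolar.target := norm_pos_iff.1 (one_pos.trans_le hz1)
      refine Or.inr ⟨i, swapPolar.symm (z, s), (T.ofExterior_eq_newTube.2 ⟨?_, ?_⟩).symm⟩
      · exact swapPolar.map_target h0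
      · rw [swapPolar.right_inv h0]
        exact h.symm
    · exact Or.inl ⟨⟨e, he⟩, rfl⟩
  · exact Or.inr ⟨v.1, (v.2.2, v.2.1), T.newTube_of_le v.1 (mem_closedBall_zero_iff.1 v.2.1.2)⟩

/-- A homeomorphism which fixes the closed tubular neighborhood pointwise induces a
homeomorphism of the surgered space. -/
theorem exists_homeomorph_surgery (T : TubularNeighborhood L I) (H : M ≃ₜ M)
    (hH : ∀ x ∈ T.closedTube, H x = x) :
    ∃ F : T.Surgery ≃ₜ T.Surgery, ∀ e : ↥(T.closedTubeᶜ), ∃ e' : ↥(T.closedTubeᶜ), (e' : M) = H e ∧ F (T.ofCompl e) = T.ofCompl e' := by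
  have hcl : T.openTube ⊆ T.closedTube := fun x ⟨i, z, s, hz, h⟩ => ⟨i, z, s, hz.le, h⟩
  have hmaps : ∀ G : M ≃ₜ M, (∀ x ∈ T.closedTube, G x = x) → ∀ A ⊆ T.closedTube,
      ∀ x, x ∈ Aᶜ → G x ∈ Aᶜ := fun G hG A hA x hx h =>
    hx ((G.injective (hG _ (hA h))) ▸ h)
  -- The map is `G` on the exterior and the identity on the solid tori; it respects the gluing
  -- because `G` fixes the boundary tori.
  let m : ∀ G : M ≃ₜ M, (∀ x ∈ T.closedTube, G x = x) → T.Surgery → T.Surgery := fun G hG =>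
    Quot.map (Sum.map (fun e => ⟨G e, hmaps G hG _ hcl _ e.2⟩) id) (by
      rintro _ _ ⟨i, z, w⟩
      have : G (T.tube i w z) = T.tube i w z := hG _ ⟨i, w, z, (Circle.norm_coe w).le, rfl⟩
      simp only [Sum.map_inl, Sum.map_inr, id, this]
      exact Glue.glue i z w)
  have hm : ∀ G hG, Continuous (m G hG) := fun G hG => by
    refine continuous_quot_lift _ (continuous_quot_mk.comp ?_)
    exact (Continuous.subtype_mk (by fun_prop) _).sumMap continuous_id
  have hs : ∀ x ∈ T.closedTube, H.symm x = x := fun x hx => by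
    rw [Homeomorph.symm_apply_eq, hH x hx]
  refine ⟨⟨⟨m H hH, m H.symm hs, ?_, ?_⟩, hm H hH, hm H.symm hs⟩, fun e =>
    ⟨⟨H e, hmaps H hH _ subset_rfl _ e.2⟩, rfl, rfl⟩⟩
  · rintro ⟨e | v⟩
    · exact congrArg T.ofExterior (Subtype.ext (H.symm_apply_apply _))
    · rfl
  · rintro ⟨e | v⟩
    · exact congrArg T.ofExterior (Subtype.ext (H.apply_symm_apply _))
    · rfl

end TubularNeighborhood

theorem FramedLink.isCompact_core {M : Type u} [TopologicalSpace M] {ι : Type v}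
    (L : FramedLink M ι) (i : ι) : IsCompact (L.core i) := by
  refine isCompact_range ?_
  have h1 : Continuous fun s : Circle =>
      (⟨i, (0, s)⟩ : (_ : ι) × (unitInterval × Circle)) :=
    continuous_sigmaMk.comp (by fun_prop)
  exact L.isEmbedding.continuous.comp h1

/-! ### The complement of the pushed meridians in the surgered space -/

namespace TubularNeighborhood

variable {M : Type u} [TopologicalSpace M] {ι : Type v} {L : FramedLink M ι} {I : Set ι}

/-- The link in `M` which consists of the cores of `L_J` and of the curves of slope `∂D² × {1}` on
the boundaries of the tubes of radius `r` around `L_I`. -/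
def meridianLink (T : TubularNeighborhood L I) (r : ℝ) : Set M :=
  {x | (∃ (i : I) (w : Circle), T.pairTube i (r * w, 1) = x) ∨ ∃ j ∉ I, x ∈ L.core j}

/-- In the new coordinates the pushed meridian is `S¹ × {r}`, parallel to the center of the new
solid torus. -/
theorem pairTube_mem_meridianLink (T : TubularNeighborhood L I) {r : ℝ} (hr : 0 < r) {i : I}
    {p : Circle × ℂ} (hp : p.2 ≠ 0) :
    T.pairTube i (swapPolar p) ∈ T.meridianLink r ↔ p.2 = r := by
  constructor
  · rintro (⟨j, w, h⟩ | ⟨j, hj, h⟩)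
    · rw [← swapPolar_ofReal hr] at h
      have := swapPolar_inj (p := (w, (r : ℂ))) (Complex.ofReal_ne_zero.2 hr.ne') hp
        (T.pairTube_inj h).2
      rw [← this]
    · exact absurd (T.pairTube_mem_core.1 h).1 fun h => hj (h ▸ i.2)
  · obtain ⟨w, y⟩ := p
    rintro rfl
    exact Or.inl ⟨i, w, by rw [swapPolar_ofReal hr]⟩

theorem isClosed_image_closedBall [T2Space M] [Finite I] (T : TubularNeighborhood L I) (R : ℝ) :
    IsClosed {x | ∃ (i : I) (q : ℂ × Circle), ‖q.1‖ ≤ R ∧ T.pairTube i q = x} := by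
  have : {x | ∃ (i : I) (q : ℂ × Circle), ‖q.1‖ ≤ R ∧ T.pairTube i q = x} =
      ⋃ i : I, T.pairTube i '' (Metric.closedBall (0 : ℂ) R ×ˢ univ) := by
    ext x
    simp
  rw [this]
  exact isClosed_iUnion_of_finite fun i => (((isCompact_closedBall _ _).prod
    isCompact_univ).image (T.isOpenEmbedding_pairTube i).continuous).isClosed

/-- The complement in the surgered space of the cores of `L_J` and of parallel copies of the
meridians is homeomorphic to the complement of `L`: there the solid tori glued in become collars
of the cores of `L_I`, and the copies of the meridians play the role of these cores. -/
theorem nonempty_homeomorph_compl_meridianLink [T2Space M] [Finite ι]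
    (T : TubularNeighborhood L I) {r : ℝ} (hr : 1 < r) :
    Nonempty (↥((T.ofCompl '' (Subtype.val ⁻¹' T.meridianLink r))ᶜ) ≃ₜ L.Complement) := by
  have hr0 : 0 < r := one_pos.trans hr
  obtain ⟨ψ, hψr, hψ⟩ := exists_homeomorph_move (p := (r : ℂ)) (R := r + 1)
    (by rw [Complex.norm_real, Real.norm_of_nonneg hr0.le]; linarith)
  have hψ0 : ∀ {y}, y ≠ (r : ℂ) → ψ y ≠ 0 := fun hy h => hy (ψ.injective (h.trans hψr.symm))
  let N : Set M := {x | ∃ (i : I) (q : ℂ × Circle), ‖q.1‖ ≤ r + 1 ∧ T.pairTube i q = x}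
  have hN : IsClosed N := T.isClosed_image_closedBall _
  have hNT : T.closedTube ⊆ N := by
    rintro x ⟨i, z, s, hz, h⟩
    exact ⟨i, (z, s), hz.trans (by linarith), h⟩
  have hmemN : ∀ {i : I} {q : ℂ × Circle}, T.pairTube i q ∈ N ↔ ‖q.1‖ ≤ r + 1 := by
    intro i q
    refine ⟨?_, fun h => ⟨i, q, h, rfl⟩⟩
    rintro ⟨j, q', hq', h⟩
    obtain ⟨rfl, rfl⟩ := T.pairTube_inj h
    exact hq'
  let A : Set M := Nᶜ ∩ ⋂ j ∈ Iᶜ, (L.core j)ᶜ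
  have hA : IsOpen A := hN.isOpen_compl.inter ((toFinite _).isOpen_biInter fun j _ =>
    (L.isCompact_core j).isClosed.isOpen_compl)
  let B : Set (Circle × ℂ) := {p | p.2 ≠ r}
  have hB : IsOpen B := isOpen_ne_fun continuous_snd continuous_const
  let a : A → ↥(T.closedTubeᶜ) := fun x => ⟨x, fun h => x.2.1 (hNT h)⟩
  have ha : IsOpenEmbedding a := by
    refine IsOpenEmbedding.of_comp a T.isClosed_closedTube.isOpen_compl.isOpenEmbedding_subtypeVal ?_
    exact hA.isOpenEmbedding_subtypeVal
  let Ψ : Circle × ℂ ≃ₜ Circle × ℂ := (Homeomorph.refl Circle).prodCongr ψ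
  have hΨ : ∀ p : B, Ψ p ∈ swapPolar.source := fun p => hψ0 p.2
  let c : ∀ i : I, B → M := fun i p => T.pairTube i (swapPolar (Ψ p))
  have hcc : ∀ i, Continuous (c i) := fun i =>
    (T.isOpenEmbedding_pairTube i).continuous.comp
      (swapPolar.continuousOn.comp_continuous (by fun_prop) hΨ)
  have hco : ∀ i, IsOpenMap (c i) := fun i U hU => by
    have h1 : IsOpen (Ψ '' (Subtype.val '' U)) := Ψ.isOpenMap _ (hB.isOpenMap_subtype_val _ hU)
    convert T.isOpen_pairTube_swapPolar_image i h1 ?_ using 1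
    · simp only [image_image, c]
    · rintro _ ⟨_, ⟨p, -, rfl⟩, rfl⟩
      exact hΨ p
  -- Both complements are presented by the same pieces: `A`, away from the large tubes and `L_J`,
  -- and the copies of `B = S¹ × (ℂ ∖ {r})`. The latter enter `M^*` as new tubes, and enter `M` as
  -- old tubes minus their cores after `ψ` moves `r` to `0`.
  let f : A ⊕ ((_ : I) × B) → T.Surgery :=
    Sum.elim (fun x => T.ofCompl (a x)) (fun b => T.newTube b.1 b.2)
  let g : A ⊕ ((_ : I) × B) → M := Sum.elim Subtype.val (fun b => c b.1 b.2)
  have hmix : ∀ (x : A) (b : (_ : I) × B), f (Sum.inl x) = f (Sum.inr b) ↔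
      g (Sum.inl x) = g (Sum.inr b) := by
    rintro x ⟨i, p⟩
    have hx := x.2.1
    -- `A` meets the tubes only beyond radius `r + 1`, where `ψ` is the identity. If it is `ψ y`
    -- that is known to lie there, then `ψ (ψ y) = ψ y` and injectivity gives `ψ y = y`.
    have hfix : ∀ y : ℂ, r + 1 < ‖ψ y‖ → ψ y = y := fun y hy => ψ.injective (hψ _ hy.le)
    change T.ofExterior _ = T.newTube i p ↔ (x : M) = c i p
    rw [T.ofExterior_eq_newTube]
    change p.1.2 ≠ 0 ∧ (x : M) = T.pairTube i (swapPolar p.1) ↔ _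
    constructor
    · rintro ⟨h0, h⟩
      rw [h, mem_compl_iff, hmemN, norm_swapPolar_fst, not_le] at hx
      have : Ψ p = p := Prod.ext rfl (hψ _ hx.le)
      rw [h]
      simp only [c, this]
    · intro h
      rw [h, mem_compl_iff, hmemN, norm_swapPolar_fst, not_le] at hx
      have h2 : ψ p.1.2 = p.1.2 := hfix _ hx
      have : Ψ p = p := Prod.ext rfl h2
      refine ⟨fun h0 => hψ0 p.2 (h2.trans h0), ?_⟩
      rw [h]
      simp only [c, this]
  obtain ⟨F, -⟩ := exists_homeomorph_range_of_isOpenMap (f := f) (g := g)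
    ((T.isOpenEmbedding_ofCompl.comp ha).continuous.sumElim (continuous_sigma fun i =>
      (T.continuous_newTube i).comp continuous_subtype_val))
    ((T.isOpenEmbedding_ofCompl.comp ha).isOpenMap.sumElim (isOpenMap_sigma.2 fun i =>
      (T.isOpenMap_newTube i).comp hB.isOpenMap_subtype_val))
    (continuous_subtype_val.sumElim (continuous_sigma hcc))
    (hA.isOpenMap_subtype_val.sumElim (isOpenMap_sigma.2 hco)) (by
      rintro (x | ⟨i, p⟩) (y | ⟨j, q⟩)
      · exact (T.isOpenEmbedding_ofCompl.comp ha).injective.eq_iff.trans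
          Subtype.val_injective.eq_iff.symm
      · exact hmix x _
      · rw [eq_comm, hmix y, eq_comm]
      · change T.newTube i p = T.newTube j q ↔ c i p = c j q
        rw [T.newTube_inj]
        simp only [c]
        constructor
        · rintro ⟨rfl, h⟩
          rw [h]
        · intro h
          obtain ⟨hij, h⟩ := T.pairTube_inj h
          exact ⟨hij, Ψ.injective (swapPolar_inj (hΨ p) (hΨ q) h)⟩)
  have hf : range f = (T.ofCompl '' (Subtype.val ⁻¹' T.meridianLink r))ᶜ := by
    have hnew : ∀ (i : I) (p : Circle × ℂ),
        T.newTube i p ∉ T.ofCompl '' (Subtype.val ⁻¹' T.meridianLink r) →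
          T.newTube i p ∈ range f := by
      intro i p hp
      refine ⟨Sum.inr ⟨i, p, fun h => hp ?_⟩, rfl⟩
      have hn : ‖p.2‖ = r := by rw [h, Complex.norm_real, Real.norm_of_nonneg hr0.le]
      have h0 : p.2 ≠ 0 := norm_pos_iff.1 (hn ▸ hr0)
      have hcl : T.pairTube i (swapPolar p) ∈ T.closedTubeᶜ := by
        rw [mem_compl_iff, pairTube_mem_closedTube, norm_swapPolar_fst, hn, not_le]
        exact hr
      exact ⟨⟨_, hcl⟩, (T.pairTube_mem_meridianLink hr0 h0).2 h,
        T.ofExterior_eq_newTube.2 ⟨h0, rfl⟩⟩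
    ext x
    constructor
    · rintro ⟨y | ⟨i, p⟩, rfl⟩ ⟨e, he, h⟩
      · rw [T.ofCompl_injective h] at he
        rcases he with ⟨i, w, hy⟩ | ⟨j, hj, hy⟩
        · refine y.2.1 ⟨i, _, ?_, hy⟩
          simp [Circle.norm_coe, abs_of_pos hr0]
        · exact mem_iInter₂.1 y.2.2 j hj hy
      · obtain ⟨h0, h1⟩ := T.ofExterior_eq_newTube.1 h
        rw [mem_preimage, show (e : M) = _ from h1, T.pairTube_mem_meridianLink hr0 h0] at he
        exact p.2 he
    · intro hx
      obtain ⟨e, rfl⟩ | ⟨i, p, rfl⟩ := T.exists_ofCompl_or_newTube x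
      · by_cases heN : (e : M) ∈ N
        · obtain ⟨i, q, -, hq⟩ := heN
          -- A point of `N` outside the closed tubes is off the core, hence also a point of a new
          -- tube.
          have hq1 : q ∈ swapPolar.target := by
            intro h0
            refine e.2 (hq ▸ T.pairTube_mem_closedTube.2 ?_)
            simp [h0]
          have : T.ofCompl e = T.newTube i (swapPolar.symm q) :=
            T.ofExterior_eq_newTube.2 ⟨swapPolar.map_target hq1,
              by rw [swapPolar.right_inv hq1]; exact hq.symm⟩
          rw [this] at hx ⊢
          exact hnew _ _ hx
        · exact ⟨Sum.inl ⟨e, heN, mem_iInter₂.2 fun j hj he =>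
            hx ⟨e, Or.inr ⟨j, hj, he⟩, rfl⟩⟩, rfl⟩
      · exact hnew _ _ hx
  have hg : range g = L.linkᶜ := by
    ext x
    constructor
    · rintro ⟨y | ⟨i, p⟩, rfl⟩ h
      · obtain ⟨j, hj⟩ := mem_iUnion.1 h
        by_cases hjI : j ∈ I
        · obtain ⟨s, hs⟩ := hj
          refine y.2.1 ⟨⟨j, hjI⟩, (0, s), ?_, (T.pairTube_zero ⟨j, hjI⟩ s).trans hs⟩
          simpa using (by linarith : (0 : ℝ) ≤ r + 1)
        · exact mem_iInter₂.1 y.2.2 j hjI hj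
      · obtain ⟨j, hj⟩ := mem_iUnion.1 h
        have h0 := (T.pairTube_mem_core.1 hj).2
        rw [← norm_eq_zero, norm_swapPolar_fst, norm_eq_zero] at h0
        exact hψ0 p.2 h0
    · intro hx
      by_cases hxN : x ∈ N
      · obtain ⟨i, q, -, rfl⟩ := hxN
        have hq : q ∈ swapPolar.target := fun h0 =>
          hx (mem_iUnion.2 ⟨i, T.pairTube_mem_core.2 ⟨rfl, h0⟩⟩)
        have hΨq : Ψ (Ψ.symm (swapPolar.symm q)) = swapPolar.symm q := Ψ.apply_symm_apply _
        refine ⟨Sum.inr ⟨i, Ψ.symm (swapPolar.symm q), fun h => ?_⟩, ?_⟩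
        · refine swapPolar.map_target hq ?_
          rw [← hΨq]
          exact (congrArg ψ h).trans hψr
        · change T.pairTube i (swapPolar (Ψ (Ψ.symm (swapPolar.symm q)))) = _
          rw [hΨq, swapPolar.right_inv hq]
      · exact ⟨Sum.inl ⟨x, hxN, mem_iInter₂.2 fun j _ hj => hx (mem_iUnion.2 ⟨j, hj⟩)⟩, rfl⟩
  exact ⟨(Homeomorph.setCongr hf.symm).trans (F.trans (Homeomorph.setCongr hg))⟩

end TubularNeighborhood

/-! ### Making the isotopy fix the tubes, and the conclusion -/

namespace ChangeOfPair

variable {M : Type u} [TopologicalSpace M] {ι : Type v} {L : FramedLink M ι}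

/-- After conjugation with a homeomorphism which shrinks the tubular neighborhoods, the isotopy
fixes these neighborhoods pointwise. -/
theorem exists_homeomorph_fixing_closedTube [T2Space M] [Finite ι] (T : ChangeOfPair L) :
    ∃ (H : M ≃ₜ M) (r : ℝ), 1 < r ∧ (∀ x ∈ T.nhd.closedTube, H x = x) ∧
      H '' T.replaced.link = T.nhd.meridianLink r := by
  obtain ⟨U, hU, hLU, hfix⟩ := T.isotopy.fixed
  set h := T.isotopy.toHomeo 1
  have hδ : ∀ᶠ ε in 𝓝[>] (0 : ℝ), ∀ i, ∀ z s, ‖z‖ ≤ 0 + ε → (z, s) ∈ T.nhd.pairTube i ⁻¹' U := by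
    refine Filter.eventually_all.2 fun i => eventually_closedBall_prod_subset
      (hU.preimage (T.nhd.isOpenEmbedding_pairTube i).continuous) le_rfl fun z s hz => ?_
    exact hLU (mem_iUnion.2 ⟨i, T.nhd.pairTube_mem_core.2 ⟨rfl, norm_le_zero_iff.1 hz⟩⟩)
  let K : Set M := ⋃ i : T.I, T.replaced.core i
  have hK : IsClosed K := isClosed_iUnion_of_finite fun i => (T.replaced.isCompact_core i).isClosed
  have hR : ∀ᶠ ε in 𝓝[>] (0 : ℝ), ∀ i, ∀ z s, ‖z‖ ≤ 1 + ε → (z, s) ∈ T.nhd.pairTube i ⁻¹' Kᶜ := by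
    refine Filter.eventually_all.2 fun i => eventually_closedBall_prod_subset
      (hK.isOpen_compl.preimage (T.nhd.isOpenEmbedding_pairTube i).continuous) zero_le_one
      fun z s hz hzK => ?_
    obtain ⟨k, t, ht⟩ := mem_iUnion.1 hzK
    refine T.notMem_closedTube k k.2 0 t ?_
    rw [ht]
    exact T.nhd.pairTube_mem_closedTube.2 hz
  -- One `δ` serves twice: the tubes of radius `δ` lie in the region `U` fixed by `h`, and those of
  -- radius `1 + δ`, which will contain the support of `ρ`, still miss the cores of `L_I^*`.
  obtain ⟨δ, ⟨hδU, hδK⟩, hδ0⟩ := ((hδ.and hR).and self_mem_nhdsWithin).exists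
  obtain ⟨σ, hσ1, hσR, r, hr, hσr⟩ := exists_homeomorph_shrink
    (show 1 < 1 + δ from lt_add_of_pos_right _ hδ0) hδ0
  let e : (_ : T.I) × (ℂ × Circle) → M := fun b => T.nhd.pairTube b.1 b.2
  have he : IsOpenEmbedding e := T.nhd.isOpenEmbedding
  let τ : (_ : T.I) × (ℂ × Circle) ≃ₜ (_ : T.I) × (ℂ × Circle) :=
    { toEquiv := Equiv.sigmaCongrRight fun _ => (σ.prodCongr (Homeomorph.refl Circle)).toEquiv
      continuous_toFun := continuous_sigma fun _ =>
        continuous_sigmaMk.comp (σ.prodCongr (Homeomorph.refl Circle)).continuous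
      continuous_invFun := continuous_sigma fun _ =>
        continuous_sigmaMk.comp (σ.prodCongr (Homeomorph.refl Circle)).symm.continuous }
  have hC : IsClosed (e '' {b | ‖b.2.1‖ ≤ 1 + δ}) := by
    convert T.nhd.isClosed_image_closedBall (1 + δ) using 1
    ext x
    simp [e]
  obtain ⟨ρ, hρ, hρ'⟩ := he.exists_homeomorph_extend τ hC (by
    rintro ⟨i, z, s⟩ hz
    have : σ z = z := hσR z (not_le.1 hz).le
    exact Sigma.ext rfl (heq_of_eq (Prod.ext this rfl)))
  have hρt : ∀ i z s, ρ (T.nhd.pairTube i (z, s)) = T.nhd.pairTube i (σ z, s) := fun i z s =>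
    hρ ⟨i, (z, s)⟩
  have hρK : ∀ x ∈ K, ρ x = x := by
    refine fun x hx => hρ' x ?_
    rintro ⟨⟨i, z, s⟩, hz, rfl⟩
    exact hδK i z s hz hx
  have hρJ : ∀ j ∉ T.I, ∀ x ∈ L.core j, ρ x = x := by
    refine fun j hj x hx => hρ' x ?_
    rintro ⟨⟨i, z, s⟩, hz, rfl⟩
    exact hj ((T.nhd.pairTube_mem_core.1 hx).1 ▸ i.2)
  have hJ : ∀ j ∉ T.I, T.replaced.core j = L.core j := fun j hj => by
    rw [FramedLink.core, FramedLink.core, T.replaced_of_notMem j hj]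
  have hHJ : ∀ j ∉ T.I, ∀ x ∈ L.core j, ρ.symm (h (ρ x)) = x := fun j hj x hx => by
    rw [hρJ j hj x hx, hfix 1 x (hLU (mem_iUnion.2 ⟨j, hx⟩)), Homeomorph.symm_apply_eq,
      hρJ j hj x hx]
  have hρr : ∀ i (w : Circle), ρ.symm (T.nhd.tube i w 1) = T.nhd.pairTube i (r * w, 1) :=
    fun i w => by
      rw [Homeomorph.symm_apply_eq, hρt, hσr]
      rfl
  -- On the closed tubes, `ρ` shrinks into `U`, `h` does nothing and `ρ.symm` undoes the shrinking.
  -- On the cores of `L_I^*`, `ρ` does nothing, `h` carries them to the meridians, and `ρ.symm`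
  -- pushes these out to radius `r`.
  refine ⟨(ρ.trans h).trans ρ.symm, r, hr, ?_, ?_⟩
  · rintro _ ⟨i, z, s, hz, rfl⟩
    change ρ.symm (h (ρ (T.nhd.pairTube i (z, s)))) = T.nhd.pairTube i (z, s)
    rw [hρt, Homeomorph.symm_apply_eq, hρt]
    exact hfix 1 _ (hδU i _ s ((hσ1 z hz).trans (zero_add δ).ge))
  · ext x
    constructor
    · rintro ⟨y, hy, rfl⟩
      obtain ⟨i, hy⟩ := mem_iUnion.1 hy
      change ρ.symm (h (ρ y)) ∈ _
      by_cases hi : i ∈ T.I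
      · rw [hρK y (mem_iUnion.2 ⟨⟨i, hi⟩, hy⟩)]
        obtain ⟨w, hw⟩ := (T.isotopy_core ⟨i, hi⟩).subset ⟨y, hy, rfl⟩
        exact Or.inl ⟨⟨i, hi⟩, w, by rw [← hρr]; exact congrArg ρ.symm hw⟩
      · rw [hJ i hi] at hy
        rw [hHJ i hi y hy]
        exact Or.inr ⟨i, hi, hy⟩
    · rintro (⟨i, w, rfl⟩ | ⟨j, hj, hx⟩)
      · obtain ⟨y, hy, hyw⟩ := (T.isotopy_core i).superset ⟨w, rfl⟩
        refine ⟨y, mem_iUnion.2 ⟨i, hy⟩, ?_⟩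
        change ρ.symm (h (ρ y)) = _
        rw [hρK y (mem_iUnion.2 ⟨i, hy⟩), ← hρr]
        exact congrArg ρ.symm hyw
      · exact ⟨x, mem_iUnion.2 ⟨j, (hJ j hj).symm ▸ hx⟩, hHJ j hj x hx⟩

theorem newLink_link [T2Space M] [Finite ι] (T : ChangeOfPair L) :
    T.newLink.link = T.nhd.ofCompl '' (Subtype.val ⁻¹' T.replaced.link) := by
  ext x
  constructor
  · intro hx
    obtain ⟨i, s, rfl⟩ := mem_iUnion.1 hx
    exact ⟨_, mem_iUnion.2 ⟨i, s, rfl⟩, rfl⟩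
  · rintro ⟨⟨y, hy'⟩, hy, rfl⟩
    obtain ⟨i, s, rfl⟩ := mem_iUnion.1 hy
    exact mem_iUnion.2 ⟨i, s, rfl⟩

end ChangeOfPair

/-- A change-of-pair operation `(M, L) ↦ (M^*, L^*)` on a framed link in a closed `3`-manifold does
not change the link complement. -/
theorem proposition1p3 {M : Type u} [TopologicalSpace M] [T2Space M] [CompactSpace M]
    [ChartedSpace (EuclideanSpace ℝ (Fin 3)) M] {n : ℕ} (L : FramedLink M (Fin n))
    (T : ChangeOfPair L) :
    Nonempty (T.newLink.Complement ≃ₜ L.Complement) := by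
  obtain ⟨H, r, hr, hH, hHL⟩ := T.exists_homeomorph_fixing_closedTube
  obtain ⟨F, hF⟩ := T.nhd.exists_homeomorph_surgery H hH
  obtain ⟨G⟩ := T.nhd.nonempty_homeomorph_compl_meridianLink hr
  -- The new link avoids the closed tubes, and there `F` acts as `H`, so it carries `L^*` to the
  -- pushed meridians together with `L_J`.
  have hFL : F '' T.newLink.linkᶜ = (T.nhd.ofCompl '' (Subtype.val ⁻¹' T.nhd.meridianLink r))ᶜ := by
    rw [image_compl_eq F.bijective, T.newLink_link, ← hHL, compl_inj_iff]
    ext x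
    constructor
    · rintro ⟨_, ⟨e, he, rfl⟩, rfl⟩
      obtain ⟨e', h1, h2⟩ := hF e
      exact ⟨e', ⟨e, he, h1.symm⟩, h2.symm⟩
    · rintro ⟨e', ⟨y, hy, hye⟩, rfl⟩
      have hy' : y ∉ T.nhd.closedTube := fun h => e'.2 (by rwa [← hye, hH y h])
      obtain ⟨e'', h1, h2⟩ := hF ⟨y, hy'⟩
      refine ⟨_, ⟨⟨y, hy'⟩, hy, rfl⟩, ?_⟩
      rw [h2, Subtype.ext (h1.trans hye)]
  exact ⟨((F.image _).trans (Homeomorph.setCongr hFL)).trans G⟩
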